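/- Let $E$ be a real Hausdorff locally convex space with topological dual $E^*$. Terminology. * A family $F$ of real functions on a set $K$ has the double limit property if for all sequences $(f_n)$ in $F$ and $(x_m)$ in $K$ the iterated limits $\lim_n\lim_m f_n(x_m)$ and $\lim_m\lim_n f_n(x_m)$ are equal whenever they both exist. * A subset $B\subseteq E$ is DLP if, for every weak-star compact equicontinuous subset $M\subseteq E^*$, the family of functions $M\to\mathbb R$, $\varphi\mapsto\varphi(x)$ $(x\in B)$, has the double limit property on $M$. The space $E$ is DLP if every bounded subset of $E$ is DLP. * $E$ is boundedly complete (quasi-complete) if every closed bounded subset of $E$ is complete. * $E$ is semi-reflexive if the canonical evaluation map from $E$ to the dual of $E^*$, where $E^*$ carries the strong topology (uniform convergence on bounded subsets of $E$), is onto. Then: (a) $E$ is semi-reflexive if and only if $E$ is boundedly complete and DLP. (b) If $E$ is boundedly complete, then the following are equivalent for every subset $B\subseteq E$: 1. $B$ is bounded and DLP; 2. $B$ is relatively weakly compact, i.e. its weak closure is weakly compact; 3. the closed convex hull $\overline{\mathrm{co}}(B)$ is weakly compact. -/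

import Mathlib

open Filter Topology

/-- Grothendieck's double limit property of a family `F` of real functions on a set `K`: for all
sequences `f n` in `F` and `x m` in `K`, the iterated limits `lim_n lim_m f n (x m)` and
`lim_m lim_n f n (x m)` are equal whenever both exist. -/
def HasDoubleLimitProperty {K : Type*} (F : Set (K → ℝ)) : Prop :=
  ∀ (f : ℕ → K → ℝ) (x : ℕ → K) (a b : ℕ → ℝ) (α β : ℝ),
    (∀ n, f n ∈ F) →
    (∀ n, Tendsto (fun m => f n (x m)) atTop (𝓝 (a n))) → Tendsto a atTop (𝓝 α) →
    (∀ m, Tendsto (fun n => f n (x m)) atTop (𝓝 (b m))) → Tendsto b atTop (𝓝 β) →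
    α = β

section LocallyConvex

variable {E : Type*} [AddCommGroup E] [Module ℝ E] [TopologicalSpace E]

/-- The members of `eqc(E*)`: the weak-star compact equicontinuous subsets of the dual. -/
def IsEquicontinuousWeakStarCompact (M : Set (WeakDual ℝ E)) : Prop :=
  IsCompact M ∧ Equicontinuous (fun (φ : M) (x : E) => (φ : WeakDual ℝ E) x)

/-- The family of functions `φ ↦ φ x`, `x ∈ B`, on a subset `M` of the dual of `E`. -/
def evalFamily (B : Set E) (M : Set (WeakDual ℝ E)) : Set (M → ℝ) :=
  (fun (x : E) (φ : M) => (φ : WeakDual ℝ E) x) '' B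

/-- A subset `B` of `E` is DLP if, as a family of functions, it has the double limit property on
every weak-star compact equicontinuous subset of the dual. -/
def IsDLPSet (B : Set E) : Prop :=
  ∀ M : Set (WeakDual ℝ E), IsEquicontinuousWeakStarCompact M →
    HasDoubleLimitProperty (evalFamily B M)

/-- A subset of `E` is relatively weakly compact if its weak closure is weakly compact. -/
def IsRelativelyWeaklyCompact (B : Set E) : Prop :=
  IsCompact (closure (toWeakSpace ℝ E '' B))

/-- A subset of `E` is weakly compact if it is compact in the weak topology. -/
def IsWeaklyCompact (B : Set E) : Prop :=
  IsCompact (toWeakSpace ℝ E '' B)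

variable (E)

/-- A space `E` is DLP if all its bounded subsets are DLP. -/
def IsDLPSpace : Prop :=
  ∀ B : Set E, Bornology.IsVonNBounded ℝ B → IsDLPSet B

/-- The canonical evaluation map from `E` to its bidual: the space of all linear functionals on the
dual of `E` which are continuous for the strong topology (uniform convergence on bounded sets). -/
def bidualEmbedding [IsTopologicalAddGroup E] [ContinuousSMul ℝ E] :
    E →ₗ[ℝ] StrongDual ℝ (StrongDual ℝ E) where
  toFun x :=
    { toFun := fun φ => φ x
      map_add' := fun _ _ => rfl
      map_smul' := fun _ _ => rfl
      cont := continuous_eval_const x }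
  map_add' x y := by ext φ; exact map_add φ x y
  map_smul' c x := by ext φ; exact map_smul φ c x

/-- `E` is semi-reflexive if the canonical map to the bidual is onto. (It is one-to-one in every
Hausdorff locally convex space.) -/
def IsSemiReflexive [IsTopologicalAddGroup E] [ContinuousSMul ℝ E] : Prop :=
  Function.Surjective (bidualEmbedding E)

end LocallyConvex

/-! Evaluation embeds `E` into `StrongDual ℝ E → ℝ`, and the weak topology is induced by the product
topology. A weakly bounded set has compact closure in this product by Tychonoff, so it is relatively
weakly compact as soon as every point `z` of that closure is evaluation at a point of `E`.

For `z` in the closure of a bounded convex DLP set `C` this takes three moves. On the polar of a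
continuous seminorm, the double limit property makes the pointwise limit `z` weak-star continuous
(Grothendieck). Sion's minimax theorem then turns pointwise approximation of `z` by `C` into uniform
approximation on the polar. Since a seminorm is a supremum over its polar, the approximants form a
Cauchy filter, and quasi-completeness supplies the point (`exists_dualEval_eq_of_mem_closure`).

In (b), a bounded DLP set is replaced by its convex hull, which keeps the double limit property on
polars by a barycenter argument. Conversely, relative weak compactness yields DLP by evaluating a
cluster functional at a cluster point, and boundedness by Mackey's theorem.

In (a), the bipolar argument places each element of the bidual in the closure of some bounded convex
set, so the above gives semi-reflexivity. Conversely, limits of a bounded set are strongly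
continuous, so semi-reflexivity makes bounded sets relatively weakly compact; this gives DLP and
completeness. -/

set_option linter.unusedSectionVars false

/-! ### Polars of continuous seminorms -/

section Polar

variable {E : Type*} [AddCommGroup E] [Module ℝ E] [TopologicalSpace E]

/-- The polar of the unit ball of a seminorm: the functionals dominated by the seminorm. -/
def seminormPolar (p : Seminorm ℝ E) : Set (WeakDual ℝ E) := {φ | ∀ x, |φ x| ≤ p x}

theorem convex_seminormPolar (p : Seminorm ℝ E) : Convex ℝ (seminormPolar p) := by
  intro φ hφ ψ hψ a b ha hb hab x
  calc |(a • φ + b • ψ) x| = |a * φ x + b * ψ x| := rfl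
    _ ≤ |a * φ x| + |b * ψ x| := abs_add_le _ _
    _ = a * |φ x| + b * |ψ x| := by rw [abs_mul, abs_mul, abs_of_nonneg ha, abs_of_nonneg hb]
    _ ≤ a * p x + b * p x :=
      add_le_add (mul_le_mul_of_nonneg_left (hφ x) ha) (mul_le_mul_of_nonneg_left (hψ x) hb)
    _ = p x := by rw [← add_mul, hab, one_mul]

theorem zero_mem_seminormPolar (p : Seminorm ℝ E) : (0 : WeakDual ℝ E) ∈ seminormPolar p :=
  fun x => (abs_zero (α := ℝ)).trans_le (apply_nonneg p x)

theorem neg_mem_seminormPolar {p : Seminorm ℝ E} {φ : WeakDual ℝ E} (hφ : φ ∈ seminormPolar p) :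
    -φ ∈ seminormPolar p := fun x => by
  have : (-φ) x = -(φ x) := rfl
  rw [this, abs_neg]; exact hφ x

variable [IsTopologicalAddGroup E] [ContinuousSMul ℝ E]

/-- Banach–Alaoglu: linearity is a closed condition on a product of compact intervals, and a linear
functional dominated by `p` is automatically continuous. -/
theorem isCompact_seminormPolar {p : Seminorm ℝ E} (hp : Continuous p) :
    IsCompact (seminormPolar p) := by
  have hind : IsInducing (fun (φ : WeakDual ℝ E) (x : E) => φ x) := ⟨rfl⟩
  rw [hind.isCompact_iff]
  have himage : (fun (φ : WeakDual ℝ E) (x : E) => φ x) '' seminormPolar p =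
      (Set.univ.pi fun x => Set.Icc (-p x) (p x)) ∩
        ({f | ∀ x y, f (x + y) = f x + f y} ∩ {f | ∀ (c : ℝ) x, f (c • x) = c * f x}) := by
    ext f
    constructor
    · rintro ⟨φ, hφ, rfl⟩
      exact ⟨fun x _ => abs_le.1 (hφ x), fun x y => map_add φ x y, fun c x => map_smul φ c x⟩
    · rintro ⟨hf, hadd, hsmul⟩
      have hbd : ∀ x, |f x| ≤ p x := fun x => abs_le.2 (hf x trivial)
      let g : E →ₗ[ℝ] ℝ := { toFun := f, map_add' := hadd, map_smul' := hsmul }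
      have hg : Continuous g := by
        apply continuous_of_continuousAt_zero g
        have h0 : Tendsto p (𝓝 0) (𝓝 0) := by simpa using hp.tendsto 0
        have : Tendsto g (𝓝 0) (𝓝 0) := squeeze_zero_norm hbd h0
        simpa [ContinuousAt] using this
      exact ⟨StrongDual.toWeakDual ⟨g, hg⟩, hbd, rfl⟩
  rw [himage]
  refine (isCompact_univ_pi fun x => isCompact_Icc).inter_right (IsClosed.inter ?_ ?_)
  · simp only [Set.ofPred_forall]
    exact isClosed_iInter fun x => isClosed_iInter fun y =>
      isClosed_eq (by fun_prop) (by fun_prop)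
  · simp only [Set.ofPred_forall]
    exact isClosed_iInter fun c => isClosed_iInter fun x =>
      isClosed_eq (by fun_prop) (by fun_prop)

theorem isEquicontinuousWeakStarCompact_seminormPolar {p : Seminorm ℝ E} (hp : Continuous p) :
    IsEquicontinuousWeakStarCompact (seminormPolar p) := by
  refine ⟨isCompact_seminormPolar hp, fun x₀ => ?_⟩
  rw [Metric.equicontinuousAt_iff_right]
  intro ε hε
  have hc : Tendsto (fun x => p (x₀ - x)) (𝓝 x₀) (𝓝 0) := by
    have : Continuous fun x => p (x₀ - x) := hp.comp (continuous_const.sub continuous_id)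
    simpa using this.tendsto x₀
  filter_upwards [hc.eventually_lt_const hε] with x hx φ
  calc dist ((φ : WeakDual ℝ E) x₀) ((φ : WeakDual ℝ E) x)
      = |(φ : WeakDual ℝ E) (x₀ - x)| := by rw [Real.dist_eq, map_sub]
    _ ≤ p (x₀ - x) := φ.2 _
    _ < ε := hx

/-- Hahn–Banach extension from the line through `x`. Uniform estimates on the polar thereby become
estimates for `p`. -/
theorem exists_mem_seminormPolar_eq [LocallyConvexSpace ℝ E] {p : Seminorm ℝ E}
    (hp : Continuous p) (x : E) : ∃ φ ∈ seminormPolar p, φ x = p x := by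
  by_cases hx : x = 0
  · exact ⟨0, zero_mem_seminormPolar p, by simp [hx]⟩
  let f : Module.Dual ℝ (ℝ ∙ x) := p x • (LinearEquiv.coord ℝ E x hx : (ℝ ∙ x) →ₗ[ℝ] ℝ)
  obtain ⟨g, hg, hgp⟩ := Module.Dual.exists_continuous_extension_of_le_seminorm_real
    (ℝ ∙ x) f hp (fun y => by
      obtain ⟨c, hc⟩ := Submodule.mem_span_singleton.1 y.2
      have : y = c • (⟨x, Submodule.mem_span_singleton_self x⟩ : ℝ ∙ x) := Subtype.ext hc.symm
      rw [this]
      simp only [f, map_smul, LinearMap.smul_apply, LinearEquiv.coe_coe,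
        LinearEquiv.coord_self, smul_eq_mul, mul_one, Submodule.coe_smul, map_smul_eq_mul,
        Real.norm_eq_abs]
      exact mul_le_mul_of_nonneg_right (le_abs_self c) (apply_nonneg p x))
  refine ⟨StrongDual.toWeakDual g, hgp, ?_⟩
  have := hg ⟨x, Submodule.mem_span_singleton_self x⟩
  simpa [f, LinearEquiv.coord_self] using this

theorem exists_mem_seminormPolar (φ : StrongDual ℝ E) :
    ∃ p : Seminorm ℝ E, Continuous p ∧ StrongDual.toWeakDual φ ∈ seminormPolar p :=
  ⟨(normSeminorm ℝ ℝ).comp (φ : E →ₗ[ℝ] ℝ), φ.continuous.norm, fun _ => le_rfl⟩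

theorem isVonNBounded_iff_forall_seminorm [LocallyConvexSpace ℝ E] {B : Set E} :
    Bornology.IsVonNBounded ℝ B ↔
      ∀ p : Seminorm ℝ E, Continuous p → ∃ R, ∀ x ∈ B, p x ≤ R := by
  rw [(PolynormableSpace.withSeminorms ℝ E).isVonNBounded_iff_seminorm_bounded]
  constructor
  · intro h p hp
    obtain ⟨r, -, hr⟩ := h ⟨p, hp⟩
    exact ⟨r, fun x hx => (hr x hx).le⟩
  · intro h p
    obtain ⟨R, hR⟩ := h p.1 p.2
    exact ⟨|R| + 1, by positivity, fun x hx => by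
      have := hR x hx
      have := le_abs_self R
      change p.1 x < _
      linarith⟩

theorem exists_seminorm_ball_subset [LocallyConvexSpace ℝ E] {U : Set E} (hU : U ∈ 𝓝 (0 : E)) :
    ∃ p : Seminorm ℝ E, Continuous p ∧ ∃ r > 0, ∀ x, p x < r → x ∈ U := by
  obtain ⟨s, r, hr, hs⟩ := (PolynormableSpace.withSeminorms ℝ E).mem_nhds_iff 0 U |>.1 hU
  refine ⟨s.sup fun p => p.1, ?_, r, hr, fun x hx => hs (by simpa [Seminorm.mem_ball] using hx)⟩
  exact Seminorm.continuous_finsetSup fun p _ => p.2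

end Polar

section DoubleLimit

/-! ### The double limit property and convex hulls -/

open MeasureTheory

/-- If all points of a compact set of sequences with a marked value `none` converge to that value,
then so do the points of the closed convex hull: they are barycenters of probability measures, and
dominated convergence applies. -/
theorem tendsto_of_mem_closure_convexHull {K : Set (Option ℕ → ℝ)} (hK : IsCompact K) {R : ℝ}
    (hR : ∀ k ∈ K, ∀ i, |k i| ≤ R)
    (h : ∀ k ∈ K, Tendsto (fun m => k (some m)) atTop (𝓝 (k none)))
    {y : Option ℕ → ℝ} (hy : y ∈ closure (convexHull ℝ K)) :
    Tendsto (fun m => y (some m)) atTop (𝓝 (y none)) := by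
  have : CompactSpace K := isCompact_iff_compactSpace.1 hK
  let e : Option ℕ → BoundedContinuousFunction K ℝ := fun i =>
    BoundedContinuousFunction.mkOfCompact
      ⟨fun k => (k : Option ℕ → ℝ) i, (continuous_apply i).comp continuous_subtype_val⟩
  let bary : ProbabilityMeasure K → Option ℕ → ℝ := fun μ i => ∫ k, e i k ∂(μ : Measure K)
  have hcont : Continuous bary := continuous_pi fun i =>
    continuous_iff_continuousAt.2 fun μ =>
      (ProbabilityMeasure.tendsto_iff_forall_integral_tendsto.1 tendsto_id) (e i)
  have hint : ∀ (μ : Measure K) [IsFiniteMeasure μ] (i), Integrable (fun k => e i k) μ :=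
    fun μ _ i => (e i).integrable μ
  -- The barycenters form a compact convex set containing `K` (through Dirac masses), hence
  -- containing the closed convex hull.
  have hclosed : IsClosed (Set.range bary) := (isCompact_range hcont).isClosed
  have hconv : Convex ℝ (Set.range bary) := by
    rintro _ ⟨μ, rfl⟩ _ ⟨ν, rfl⟩ s t hs ht hst
    let ρ : Measure K := ENNReal.ofReal s • (μ : Measure K) + ENNReal.ofReal t • (ν : Measure K)
    have hρ : IsProbabilityMeasure ρ := ⟨by
      simp [ρ, ← ENNReal.ofReal_add hs ht, hst]⟩
    refine ⟨⟨ρ, hρ⟩, funext fun i => ?_⟩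
    change ∫ k, e i k ∂ρ = _
    rw [integral_add_measure ((hint _ i).smul_measure ENNReal.ofReal_ne_top)
      ((hint _ i).smul_measure ENNReal.ofReal_ne_top), integral_smul_measure,
      integral_smul_measure, ENNReal.toReal_ofReal hs, ENNReal.toReal_ofReal ht]
    rfl
  have hsub : K ⊆ Set.range bary := fun k hk => by
    refine ⟨⟨Measure.dirac ⟨k, hk⟩, inferInstance⟩, funext fun i => ?_⟩
    change ∫ k', e i k' ∂(Measure.dirac (⟨k, hk⟩ : K)) = _
    rw [integral_dirac]
    rfl
  obtain ⟨μ, rfl⟩ := closure_minimal (convexHull_min hsub hconv) hclosed hy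
  exact tendsto_integral_of_dominated_convergence (fun _ => R)
    (fun m => (hint _ _).aestronglyMeasurable) (integrable_const R)
    (fun m => ae_of_all _ fun k => hR k k.2 _) (ae_of_all _ fun k => h k k.2)

/-- The double limit property of a uniformly bounded family passes to the convex hull. -/
theorem HasDoubleLimitProperty.convexHull {K : Type*} {F : Set (K → ℝ)}
    (hF : HasDoubleLimitProperty F) {R : ℝ} (hR : ∀ f ∈ F, ∀ x, |f x| ≤ R) :
    HasDoubleLimitProperty (convexHull ℝ F) := by
  intro f x a b α β hf ha hα hb hβ
  -- Only countably many members of `F` enter the combinations `f n`, so one subsequence of `x`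
  -- makes all of them converge.
  have hfin : ∀ n, ∃ t : Finset (K → ℝ), (t : Set (K → ℝ)) ⊆ F ∧
      f n ∈ _root_.convexHull ℝ (t : Set (K → ℝ)) := fun n => by
    have := hf n
    rw [convexHull_eq_union_convexHull_finite_subsets] at this
    simpa using this
  choose t htF hft using hfin
  let G : Set (K → ℝ) := ⋃ n, (t n : Set (K → ℝ))
  have hGF : G ⊆ F := Set.iUnion_subset htF
  have : Countable G := (Set.countable_iUnion fun n => (t n).countable_toSet).to_subtype
  obtain ⟨c, -, φ, hφ, hc⟩ := (isCompact_univ_pi fun _ : G => isCompact_Icc (a := -R) (b := R))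
    |>.tendsto_subseq (x := fun m (g : G) => (g : K → ℝ) (x m))
      fun m g _ => abs_le.1 (hR g (hGF g.2) _)
  have hc' : ∀ g : G, Tendsto (fun m => (g : K → ℝ) (x (φ m))) atTop (𝓝 (c g)) :=
    tendsto_pi_nhds.1 hc
  -- Values along the subsequence, with the limit stored at `none`.
  let e : G → Option ℕ → ℝ := fun g i => i.elim (c g) fun m => (g : K → ℝ) (x (φ m))
  have heR : ∀ g i, e g i ∈ Set.Icc (-R) R := by
    rintro g (_ | m)
    · exact isClosed_Icc.mem_of_tendsto (hc' g)
        (Eventually.of_forall fun m => abs_le.1 (hR g (hGF g.2) _))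
    · exact abs_le.1 (hR g (hGF g.2) _)
  let P : Set (Option ℕ → ℝ) := Set.univ.pi fun _ => Set.Icc (-R) R
  have hP : IsCompact P := isCompact_univ_pi fun _ => isCompact_Icc
  have hSP : closure (Set.range e) ⊆ P :=
    closure_minimal (Set.range_subset_iff.2 fun g i _ => heR g i) hP.isClosed
  -- This is where the hypothesis on `F` enters: `k` is a sequential limit of points `e (g n)`, and
  -- any subsequential limit `δ` of its values is one iterated limit while `k none` is the other.
  have hlim : ∀ k ∈ closure (Set.range e), Tendsto (fun m => k (some m)) atTop (𝓝 (k none)) := by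
    intro k hk
    obtain ⟨s, hs, hsk⟩ := mem_closure_iff_seq_limit.1 hk
    choose g hg using hs
    obtain rfl : (fun n => e (g n)) = s := funext hg
    rw [tendsto_pi_nhds] at hsk
    refine tendsto_of_subseq_tendsto fun ns hns => ?_
    obtain ⟨δ, -, ms, hms, hδ⟩ := (isCompact_Icc (a := -R) (b := R)).tendsto_subseq
      (x := fun m => k (some (ns m))) fun m => hSP hk _ trivial
    have : k none = δ := hF (fun n => g n) (fun l => x (φ (ns (ms l)))) (fun n => c (g n))
      (fun l => k (some (ns (ms l)))) _ _ (fun n => hGF (g n).2)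
      (fun n => (hc' (g n)).comp (hns.comp hms.tendsto_atTop)) (hsk none)
      (fun l => hsk (some (ns (ms l)))) hδ
    exact ⟨ms, this ▸ hδ⟩
  have hrep : _root_.convexHull ℝ G ⊆ {h | ∃ y ∈ _root_.convexHull ℝ (Set.range e),
      (∀ m, h (x (φ m)) = y (some m)) ∧
        Tendsto (fun m => h (x (φ m))) atTop (𝓝 (y none))} := by
    refine convexHull_min (fun g hg => ⟨e ⟨g, hg⟩, subset_convexHull ℝ _ ⟨_, rfl⟩,
      fun m => rfl, hc' ⟨g, hg⟩⟩) ?_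
    rintro h ⟨y, hy, hym, hyl⟩ h' ⟨y', hy', hym', hyl'⟩ r s hr hs hrs
    refine ⟨r • y + s • y', convex_convexHull ℝ _ hy hy' hr hs hrs, fun m => ?_, ?_⟩
    · simp [hym, hym']
    · exact (hyl.const_mul r).add (hyl'.const_mul s)
  have hmem : ∀ n, (fun i : Option ℕ => i.elim (a n) fun m => f n (x (φ m))) ∈
      _root_.convexHull ℝ (Set.range e) := by
    intro n
    obtain ⟨y, hy, hym, hyl⟩ := hrep (convexHull_mono (Set.subset_iUnion _ n) (hft n))
    have hya : y none = a n := tendsto_nhds_unique hyl ((ha n).comp hφ.tendsto_atTop)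
    convert hy using 1
    ext (_ | m)
    · exact hya.symm
    · exact hym m
  have hy : (fun i : Option ℕ => i.elim α fun m => b (φ m)) ∈
      closure (_root_.convexHull ℝ (closure (Set.range e))) := by
    refine closure_mono (convexHull_mono subset_closure)
      (mem_closure_of_tendsto (b := atTop) (tendsto_pi_nhds.2 ?_) (Eventually.of_forall hmem))
    rintro (_ | m)
    · exact hα
    · exact hb (φ m)
  have := tendsto_of_mem_closure_convexHull (hP.of_isClosed_subset isClosed_closure hSP)
    (fun k hk i => abs_le.2 (hSP hk i trivial)) hlim hy
  exact tendsto_nhds_unique this (hβ.comp hφ.tendsto_atTop)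

end DoubleLimit

/-! ### Continuity of pointwise limits -/

section Continuity

/-- A pointwise limit of a uniformly bounded family of continuous functions with the double limit
property is continuous. -/
theorem HasDoubleLimitProperty.continuous_of_mem_closure {X : Type*} [TopologicalSpace X]
    {F : Set (X → ℝ)} (hF : HasDoubleLimitProperty F) (hc : ∀ f ∈ F, Continuous f) {R : ℝ}
    (hR : ∀ f ∈ F, ∀ x, |f x| ≤ R) {z : X → ℝ} (hz : z ∈ closure F) : Continuous z := by
  refine continuous_iff_continuousAt.2 fun x₀ => ?_
  by_contra hcont
  rw [ContinuousAt, Metric.tendsto_nhds] at hcont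
  push Not at hcont
  obtain ⟨ε, hε, hfreq⟩ := hcont
  have hzR : ∀ x, z x ∈ Set.Icc (-R) R := by
    have hcl : IsClosed (Set.univ.pi fun _ : X => Set.Icc (-R) R) :=
      isClosed_set_pi fun _ _ => isClosed_Icc
    have hsub : F ⊆ Set.univ.pi fun _ : X => Set.Icc (-R) R :=
      fun f hf x _ => abs_le.1 (hR f hf x)
    exact fun x => closure_minimal hsub hcl hz x trivial
  -- Inductive choice of triples (index, function, point): each new function is close to `z` at `x₀`
  -- and at all earlier points, and each new point is close to `x₀` as seen by all earlier functions
  -- while `z` stays `ε` away from `z x₀` there. The strictly increasing index drives the errors to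
  -- zero. The iterated limits are then `z x₀` and a limit of the values of `z`, at distance at
  -- least `ε`.
  obtain ⟨s, hs, hsr⟩ := exists_seq_of_forall_finset_exists
    (fun t : ℕ × (X → ℝ) × X => t.2.1 ∈ F ∧ ε ≤ dist (z t.2.2) (z x₀) ∧
      dist (t.2.1 x₀) (z x₀) < 1 / ((t.1 : ℝ) + 1))
    (fun t t' => t.1 < t'.1 ∧ dist (t'.2.1 t.2.2) (z t.2.2) < 1 / ((t'.1 : ℝ) + 1) ∧
      dist (t.2.1 t'.2.2) (t.2.1 x₀) < 1 / ((t'.1 : ℝ) + 1)) (by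
    intro S hS
    let k := S.sup (fun t => t.1) + 1
    have hδ : (0 : ℝ) < 1 / ((k : ℝ) + 1) := by positivity
    have hev : ∀ x, ∀ᶠ g in 𝓝 z, dist (g x) (z x) < 1 / ((k : ℝ) + 1) := fun x =>
      Metric.tendsto_nhds.1 ((continuous_apply x).tendsto z) _ hδ
    obtain ⟨f, hfF, hf₀, hfS⟩ := ((mem_closure_iff_frequently.1 hz).and_eventually
      ((hev x₀).and ((Filter.eventually_all_finset S).2 fun t _ => hev t.2.2))).exists
    have hevx : ∀ᶠ x in 𝓝 x₀, ∀ t ∈ S, dist (t.2.1 x) (t.2.1 x₀) < 1 / ((k : ℝ) + 1) :=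
      (Filter.eventually_all_finset S).2 fun t ht =>
        Metric.tendsto_nhds.1 ((hc _ (hS t ht).1).tendsto x₀) _ hδ
    obtain ⟨x, hxε, hxS⟩ := (hfreq.and_eventually hevx).exists
    exact ⟨(k, f, x), ⟨hfF, hxε, hf₀⟩, fun t ht =>
      ⟨Nat.lt_succ_of_le (Finset.le_sup (f := fun t : ℕ × (X → ℝ) × X => t.1) ht),
        hfS t ht, hxS t ht⟩⟩)
  have hmono : StrictMono fun n => (s n).1 := fun m n h => (hsr m n h).1
  have hzero : Tendsto (fun n => 1 / (((s n).1 : ℝ) + 1)) atTop (𝓝 0) :=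
    tendsto_one_div_add_atTop_nhds_zero_nat.comp hmono.tendsto_atTop
  obtain ⟨β, -, φ, hφ, hβ⟩ := (isCompact_Icc (a := -R) (b := R)).tendsto_subseq
    (x := fun m => z (s m).2.2) fun m => hzR _
  have heq : z x₀ = β := hF (fun n => (s n).2.1) (fun m => (s (φ m)).2.2)
    (fun n => (s n).2.1 x₀) (fun m => z (s (φ m)).2.2) _ _ (fun n => (hs n).1)
    (fun n => by
      have : Tendsto (fun m => (s n).2.1 (s m).2.2) atTop (𝓝 ((s n).2.1 x₀)) := by
        rw [tendsto_iff_dist_tendsto_zero]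
        exact squeeze_zero' (Eventually.of_forall fun _ => dist_nonneg)
          ((eventually_gt_atTop n).mono fun m hm => (hsr n m hm).2.2.le) hzero
      exact this.comp hφ.tendsto_atTop)
    (by
      rw [tendsto_iff_dist_tendsto_zero]
      exact squeeze_zero (fun _ => dist_nonneg) (fun n => (hs n).2.2.le) hzero)
    (fun m => by
      rw [tendsto_iff_dist_tendsto_zero]
      exact squeeze_zero' (Eventually.of_forall fun _ => dist_nonneg)
        ((eventually_gt_atTop (φ m)).mono fun n hn => (hsr (φ m) n hn).2.1.le) hzero) hβ
  have : ε ≤ dist β (z x₀) := ge_of_tendsto (hβ.dist tendsto_const_nhds)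
    (Eventually.of_forall fun m => (hs (φ m)).2.1)
  rw [heq, dist_self] at this
  exact absurd hε this.not_gt

end Continuity

/-! ### From pointwise to uniform approximation -/

section Approximation

variable {E : Type*} [AddCommGroup E] [Module ℝ E] [TopologicalSpace E]

/-- A point of `E` as a function on the dual of `E`. -/
def dualEval (x : E) (φ : StrongDual ℝ E) : ℝ := φ x

theorem map_lincomb_of_mem_closure_dualEval {C : Set E} {z : StrongDual ℝ E → ℝ}
    (hz : z ∈ closure (dualEval '' C)) (a b : ℝ) (φ ψ : StrongDual ℝ E) :
    z (a • φ + b • ψ) = a * z φ + b * z ψ := by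
  have hcl : IsClosed {w : StrongDual ℝ E → ℝ | w (a • φ + b • ψ) = a * w φ + b * w ψ} :=
    isClosed_eq (by fun_prop) (by fun_prop)
  refine closure_minimal ?_ hcl hz
  rintro _ ⟨x, -, rfl⟩
  rfl

variable [IsTopologicalAddGroup E] [ContinuousSMul ℝ E]

/-- A minimax argument: `φ c - z φ` is linear in `φ` and affine in `c`, and the polar is compact, so
a choice of `c` depending on `φ` can be replaced by a single `c`. -/
theorem exists_forall_seminormPolar_abs_sub_lt {C : Set E} (hC : Convex ℝ C)
    {z : StrongDual ℝ E → ℝ} (hz : z ∈ closure (dualEval '' C)) {p : Seminorm ℝ E}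
    (hp : Continuous p)
    (hcont : ContinuousOn (fun φ : WeakDual ℝ E => z (WeakDual.toStrongDual φ)) (seminormPolar p))
    {ε : ℝ} (hε : 0 < ε) :
    ∃ c ∈ C, ∀ φ ∈ seminormPolar p, |φ c - z (WeakDual.toStrongDual φ)| < ε := by
  let f : WeakDual ℝ E → E → ℝ := fun φ c => φ c - z (WeakDual.toStrongDual φ)
  have hlin := map_lincomb_of_mem_closure_dualEval hz
  have hf : ∀ c, ContinuousOn (fun φ => f φ c) (seminormPolar p) := fun c =>
    (WeakDual.eval_continuous c).continuousOn.sub hcont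
  have hK := isCompact_seminormPolar hp
  -- Compactness reduces the pointwise approximants to finitely many, as the finite form of Sion's
  -- theorem requires.
  obtain ⟨T, hT⟩ : ∃ T : Finset C, ∀ φ ∈ seminormPolar p, ∃ c ∈ T, -ε < f φ c := by
    have hnhds : ∀ φ ∈ seminormPolar p, ∃ c : C, {ψ | -ε < f ψ c} ∈ 𝓝[seminormPolar p] φ := by
      intro φ hφ
      have hev : ∀ᶠ w in 𝓝 z, dist (w (WeakDual.toStrongDual φ)) (z (WeakDual.toStrongDual φ)) < ε :=
        Metric.tendsto_nhds.1 ((continuous_apply _).tendsto z) _ hε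
      obtain ⟨_, ⟨c, hc, rfl⟩, hcφ⟩ := ((mem_closure_iff_frequently.1 hz).and_eventually hev).exists
      exact ⟨⟨c, hc⟩, (hf c φ hφ).eventually (lt_mem_nhds (abs_lt.1 hcφ).1)⟩
    have : Nonempty C := let ⟨c, _⟩ := hnhds 0 (zero_mem_seminormPolar p); ⟨c⟩
    choose! c hc using hnhds
    obtain ⟨t, -, ht⟩ := hK.elim_nhdsWithin_subcover (fun φ => {ψ | -ε < f ψ (c φ)}) hc
    classical
    refine ⟨t.image c, fun φ hφ => ?_⟩
    obtain ⟨ψ, hψ, hψφ⟩ := Set.mem_iUnion₂.1 (ht hφ)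
    exact ⟨c ψ, Finset.mem_image_of_mem c hψ, hψφ⟩
  obtain ⟨c, hc, hcφ⟩ := Sion.exists_lt_iInf_of_lt_iInf_of_finite
    (X := seminormPolar p) (Y := C) (f := f) ⟨0, zero_mem_seminormPolar p⟩ hK
    (fun c _ => (hf c).lowerSemicontinuousOn)
    (fun c _ => by
      refine ConvexOn.quasiconvexOn ⟨convex_seminormPolar p, ?_⟩
      intro φ _ ψ _ a b _ _ _
      have h1 : (a • φ + b • ψ) c = a * φ c + b * ψ c := rfl
      have h2 := hlin a b (WeakDual.toStrongDual φ) (WeakDual.toStrongDual ψ)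
      rw [← map_smul, ← map_smul, ← map_add] at h2
      simp only [f, h1, h2, smul_eq_mul]
      linarith)
    hC (fun φ _ => ((map_continuous (WeakDual.toStrongDual φ)).sub
      continuous_const).continuousOn.upperSemicontinuousOn)
    (fun φ _ => by
      refine ConcaveOn.quasiconcaveOn ⟨hC, ?_⟩
      intro x _ y _ a b _ _ hab
      have h1 : φ (a • x + b • y) = a * φ x + b * φ y := by simp
      simp only [f, h1, smul_eq_mul]
      linear_combination (-z (WeakDual.toStrongDual φ)) * hab)
    (convex_seminormPolar p) (s := Subtype.val '' (T : Set C)) (T.finite_toSet.image _)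
    (Subtype.coe_image_subset _ _) (t := -ε)
    (fun φ hφ => by
      obtain ⟨c, hc, h⟩ := hT φ hφ
      exact ⟨c, ⟨c, hc, rfl⟩, h⟩)
  refine ⟨c, hc, fun φ hφ => abs_lt.2 ⟨hcφ φ hφ, ?_⟩⟩
  -- Minimax gives only a lower bound; symmetry of the polar supplies the upper one.
  have h1 := hcφ (-φ) (neg_mem_seminormPolar hφ)
  have h2 := hlin (-1) 0 (WeakDual.toStrongDual φ) 0
  have h3 : (-φ) c = -φ c := rfl
  have h4 : WeakDual.toStrongDual (-φ) = (-1 : ℝ) • WeakDual.toStrongDual φ +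
    (0 : ℝ) • (0 : StrongDual ℝ E) :=
    ContinuousLinearMap.ext fun x => by
      change -(φ x) = -1 * φ x + 0 * 0
      ring
  simp only [f, h3, h4, h2] at h1
  linarith

end Approximation

/-! ### Representing limits by points, using completeness -/

section Completeness

variable {E : Type*} [AddCommGroup E] [Module ℝ E] [UniformSpace E] [IsUniformAddGroup E]
  [ContinuousSMul ℝ E] [LocallyConvexSpace ℝ E]

/-- Functions on the dual which are limits of points of a bounded convex set uniformly on polars of
continuous seminorms are represented by points, if the closure of the set is complete. -/
theorem exists_mem_closure_dualEval_eq {C : Set E} (hC : IsComplete (closure C))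
    {z : StrongDual ℝ E → ℝ} (hlin : ∀ (a : ℝ) (φ), z (a • φ) = a * z φ)
    (happ : ∀ p : Seminorm ℝ E, Continuous p →
      ∃ c ∈ C, ∀ φ ∈ seminormPolar p, |φ c - z (WeakDual.toStrongDual φ)| ≤ 1) :
    ∃ x ∈ closure C, dualEval x = z := by
  let A : {p : Seminorm ℝ E // Continuous p} → Set E := fun p =>
    {c ∈ C | ∀ φ ∈ seminormPolar p.1, |φ c - z (WeakDual.toStrongDual φ)| ≤ 1}
  let l : Filter E := ⨅ p, 𝓟 (A p)
  have hA : ∀ p, A p ∈ l := fun p => mem_iInf_of_mem p (mem_principal_self _)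
  have hdir : Directed (· ≥ ·) fun p => 𝓟 (A p) := by
    intro p q
    refine ⟨⟨p.1 ⊔ q.1, p.2.sup q.2⟩, ?_, ?_⟩ <;> refine principal_mono.2 fun c hc =>
      ⟨hc.1, fun φ hφ => hc.2 φ fun x => (hφ x).trans ?_⟩
    · exact le_sup_left
    · exact le_sup_right
  have : Nonempty {p : Seminorm ℝ E // Continuous p} := ⟨⟨0, continuous_const⟩⟩
  have hne : l.NeBot := iInf_neBot_of_directed' hdir fun p =>
    principal_neBot_iff.2 (let ⟨c, hc, h⟩ := happ p.1 p.2; ⟨c, hc, h⟩)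
  have hsmul : ∀ (p : Seminorm ℝ E), Continuous p → ∀ t : ℝ, 0 ≤ t →
      ∃ q : Seminorm ℝ E, Continuous q ∧ ∀ x, q x = t * p x := fun p hp t ht =>
    let r : NNReal := ⟨t, ht⟩
    ⟨r • p, continuous_const.mul hp, fun x => rfl⟩
  have hcauchy : Cauchy l := by
    refine cauchy_iff.2 ⟨hne, fun s hs => ?_⟩
    rw [uniformity_eq_comap_nhds_zero] at hs
    obtain ⟨U, hU, hUs⟩ := hs
    obtain ⟨p, hp, r, hr, hpU⟩ := exists_seminorm_ball_subset hU
    -- Two members of `A q` differ by at most 2 on the polar of `q`, so `p (c' - c) ≤ 2 * r / 3 <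
    -- r`.
    obtain ⟨q, hqc, hq⟩ := hsmul p hp (3 / r) (by positivity)
    refine ⟨_, hA ⟨_, hqc⟩, ?_⟩
    rintro ⟨c, c'⟩ ⟨hc, hc'⟩
    refine hUs (hpU _ ?_)
    obtain ⟨φ, hφ, hφc⟩ := exists_mem_seminormPolar_eq hqc (c' - c)
    have h1 := abs_le.1 (hc.2 φ hφ)
    have h2 := abs_le.1 (hc'.2 φ hφ)
    rw [hq, map_sub, div_mul_eq_mul_div, eq_div_iff hr.ne'] at hφc
    change p (c' - c) < r
    nlinarith
  obtain ⟨x, hx, hlx⟩ := hC l hcauchy (le_principal_iff.2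
    (mem_of_superset (hA ⟨0, continuous_const⟩) fun c hc => subset_closure hc.1))
  refine ⟨x, hx, funext fun φ => ?_⟩
  refine tendsto_nhds_unique ((φ.continuous.tendsto x).mono_left hlx) ?_
  refine Metric.tendsto_nhds.2 fun ε hε => ?_
  obtain ⟨p, hp, hφp⟩ := exists_mem_seminormPolar φ
  -- The polar of `q` contains `(2 / ε) • φ`, so error 1 there means error at most `ε / 2` at `φ`.
  obtain ⟨q, hqc, hq⟩ := hsmul p hp (2 / ε) (by positivity)
  filter_upwards [hA ⟨_, hqc⟩] with c hc
  have h1 := hc.2 (StrongDual.toWeakDual ((2 / ε) • φ)) fun y => by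
    rw [hq]
    change |2 / ε * φ y| ≤ _
    rw [abs_mul, abs_of_pos (by positivity : 0 < 2 / ε)]
    exact mul_le_mul_of_nonneg_left (hφp y) (by positivity)
  have h2 : WeakDual.toStrongDual (StrongDual.toWeakDual ((2 / ε) • φ)) = (2 / ε) • φ := rfl
  have h3 : (StrongDual.toWeakDual ((2 / ε) • φ)) c = 2 / ε * φ c := rfl
  rw [h2, h3, hlin, ← mul_sub, abs_mul, abs_of_pos (by positivity : 0 < 2 / ε),
    div_mul_eq_mul_div, div_le_iff₀ hε] at h1
  rw [Real.dist_eq]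
  change |φ c - z φ| < ε
  linarith

theorem exists_dualEval_eq_of_mem_closure [T2Space E] [QuasiCompleteSpace ℝ E] {C : Set E} (hC : Convex ℝ C)
    (hb : Bornology.IsVonNBounded ℝ C)
    (hdlp : ∀ p : Seminorm ℝ E, Continuous p →
      HasDoubleLimitProperty (evalFamily C (seminormPolar p)))
    {z : StrongDual ℝ E → ℝ} (hz : z ∈ closure (dualEval '' C)) :
    ∃ x ∈ closure C, dualEval x = z := by
  refine exists_mem_closure_dualEval_eq
    (QuasiCompleteSpace.quasiComplete (𝕜 := ℝ) hb.closure isClosed_closure)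
    (fun a φ => by simpa using map_lincomb_of_mem_closure_dualEval hz a 0 φ 0) fun p hp => ?_
  obtain ⟨R, hR⟩ := isVonNBounded_iff_forall_seminorm.1 hb p hp
  have hcont : Continuous fun φ : seminormPolar p => z (WeakDual.toStrongDual (φ : WeakDual ℝ E)) := by
    refine (hdlp p hp).continuous_of_mem_closure (R := R) ?_ ?_ ?_
    · rintro _ ⟨x, -, rfl⟩
      exact (WeakDual.eval_continuous x).comp continuous_subtype_val
    · rintro _ ⟨x, hx, rfl⟩ φ
      exact (φ.2 x).trans (hR x hx)
    · let r : (StrongDual ℝ E → ℝ) → seminormPolar p → ℝ := fun w φ =>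
        w (WeakDual.toStrongDual (φ : WeakDual ℝ E))
      have hr : Continuous r := continuous_pi fun φ => continuous_apply _
      have := image_closure_subset_closure_image hr (Set.mem_image_of_mem r hz)
      rwa [Set.image_image] at this
  obtain ⟨c, hc, h⟩ := exists_forall_seminormPolar_abs_sub_lt hC hz hp
    (continuousOn_iff_continuous_domRestrict.2 hcont) one_pos
  exact ⟨c, hc, fun φ hφ => (h φ hφ).le⟩

end Completeness

/-! ### Weak compactness, the double limit property and Mackey's theorem -/

section WeakCompactness

variable {E : Type*} [AddCommGroup E] [Module ℝ E] [TopologicalSpace E]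

theorem isInducing_dualEval :
    IsInducing fun x : WeakSpace ℝ E => dualEval ((toWeakSpace ℝ E).symm x) := ⟨rfl⟩

theorem image_dualEval_toWeakSpace (B : Set E) :
    (fun x : WeakSpace ℝ E => dualEval ((toWeakSpace ℝ E).symm x)) '' (toWeakSpace ℝ E '' B) =
      dualEval '' B := by
  rw [Set.image_image]; rfl

theorem isCompact_closure_dualEval {B : Set E} {b : StrongDual ℝ E → ℝ}
    (hB : ∀ x ∈ B, ∀ φ : StrongDual ℝ E, |φ x| ≤ b φ) : IsCompact (closure (dualEval '' B)) := by
  have hP : IsCompact (Set.univ.pi fun φ : StrongDual ℝ E => Set.Icc (-b φ) (b φ)) :=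
    isCompact_univ_pi fun φ => isCompact_Icc
  refine hP.of_isClosed_subset isClosed_closure (closure_minimal ?_ hP.isClosed)
  rintro _ ⟨x, hx, rfl⟩ φ -
  exact abs_le.1 (hB x hx φ)

/-- A bounded set is relatively weakly compact if all its limit points in the space of functions on
the dual are points of the space. -/
theorem isRelativelyWeaklyCompact_of_closure_subset {B : Set E}
    (hB : ∀ φ : StrongDual ℝ E, ∃ R, ∀ x ∈ B, |φ x| ≤ R)
    (h : closure (dualEval '' B) ⊆ Set.range (dualEval (E := E))) :
    IsRelativelyWeaklyCompact B := by
  choose b hb using hB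
  rw [IsRelativelyWeaklyCompact, isInducing_dualEval.closure_eq_preimage_closure_image,
    isInducing_dualEval.isCompact_preimage_iff, image_dualEval_toWeakSpace]
  · exact isCompact_closure_dualEval fun x hx φ => hb φ x hx
  · rw [image_dualEval_toWeakSpace]
    intro w hw
    obtain ⟨x, rfl⟩ := h hw
    exact ⟨toWeakSpace ℝ E x, rfl⟩

theorem Bornology.IsVonNBounded.exists_abs_dual_le {B : Set E} (hB : IsVonNBounded ℝ B)
    (φ : StrongDual ℝ E) : ∃ R, ∀ x ∈ B, |φ x| ≤ R := by
  obtain ⟨R, hR⟩ := (NormedSpace.isVonNBounded_iff ℝ |>.1 (hB.image φ)).exists_norm_le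
  exact ⟨R, fun x hx => hR _ ⟨x, hx, rfl⟩⟩

theorem continuous_weakSpace_dual (φ : StrongDual ℝ E) :
    Continuous fun x : WeakSpace ℝ E => φ ((toWeakSpace ℝ E).symm x) :=
  (continuous_apply φ).comp isInducing_dualEval.continuous

/-- Relatively weakly compact sets have the double limit property on every weak-star compact
subset of the dual. -/
theorem IsRelativelyWeaklyCompact.isDLPSet {B : Set E} (hB : IsRelativelyWeaklyCompact B) :
    IsDLPSet B := by
  intro M hM f φ a b α β hf ha hα hb hβ
  choose x hxB hx using hf
  -- Both iterated limits will equal the value of the cluster functional `φ₀` at the weak cluster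
  -- point `x₀`.
  obtain ⟨x₀, -, hx₀⟩ := hB.exists_mapClusterPt_of_frequently (l := atTop)
    (f := fun n => toWeakSpace ℝ E (x n))
    (Eventually.of_forall fun n => subset_closure
      (Set.mem_image_of_mem _ (hxB n))).frequently
  obtain ⟨φ₀, -, hφ₀⟩ := hM.1.exists_mapClusterPt_of_frequently (l := atTop)
    (f := fun m => (φ m : WeakDual ℝ E)) (Eventually.of_forall fun m => (φ m).2).frequently
  have hfx : ∀ n m, f n (φ m) = (φ m : WeakDual ℝ E) (x n) := fun n m => by rw [← hx]
  simp only [hfx] at ha hb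
  have hcl : ∀ {u : ℕ → ℝ} {s t : ℝ}, Tendsto u atTop (𝓝 s) → MapClusterPt t atTop u → t = s :=
    fun hu ht =>
      have ⟨_, hψ, h⟩ := ht.tendsto_subseq
      tendsto_nhds_unique h (hu.comp hψ.tendsto_atTop)
  have hxφ : ∀ ψ : WeakDual ℝ E, MapClusterPt (ψ ((toWeakSpace ℝ E).symm x₀)) atTop
      fun n => ψ (x n) := fun ψ =>
    MapClusterPt.continuousAt_comp
      (f := fun w : WeakSpace ℝ E => (WeakDual.toStrongDual ψ) ((toWeakSpace ℝ E).symm w))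
      (continuous_weakSpace_dual (WeakDual.toStrongDual ψ)).continuousAt hx₀
  have hφx : ∀ y : E, MapClusterPt (φ₀ y) atTop fun m => (φ m : WeakDual ℝ E) y := fun y =>
    hφ₀.continuousAt_comp (WeakDual.eval_continuous y).continuousAt
  have ha' : ∀ n, φ₀ (x n) = a n := fun n => hcl (ha n) (hφx _)
  have hb' : ∀ m, (φ m : WeakDual ℝ E) ((toWeakSpace ℝ E).symm x₀) = b m :=
    fun m => hcl (hb m) (hxφ _)
  have h1 := hxφ φ₀
  have h2 := hφx ((toWeakSpace ℝ E).symm x₀)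
  simp only [ha'] at h1
  simp only [hb'] at h2
  rw [← hcl hα h1, ← hcl hβ h2]

variable [IsTopologicalAddGroup E] [ContinuousSMul ℝ E] [LocallyConvexSpace ℝ E]

/-- Mackey's theorem: weakly bounded sets are bounded. -/
theorem isVonNBounded_of_forall_dual {B : Set E}
    (hB : ∀ φ : StrongDual ℝ E, ∃ R, ∀ x ∈ B, |φ x| ≤ R) : Bornology.IsVonNBounded ℝ B := by
  refine isVonNBounded_iff_forall_seminorm.2 fun p hp => ?_
  have hK := isCompact_seminormPolar hp
  have : CompactSpace (seminormPolar p) := isCompact_iff_compactSpace.1 hK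
  have : Nonempty (seminormPolar p) := ⟨⟨0, zero_mem_seminormPolar p⟩⟩
  -- Baire category in the compact polar: some uniform bound `n` holds near some `φ₀`. Compactness
  -- then gives one `t` that moves every `φ` of the polar into this neighbourhood.
  obtain ⟨n, φ₀, hφ₀⟩ := nonempty_interior_of_iUnion_of_closed
    (f := fun n : ℕ => {φ : seminormPolar p | ∀ x ∈ B, |(φ : WeakDual ℝ E) x| ≤ n})
    (fun n => by
      simp only [Set.ofPred_forall]
      exact isClosed_iInter fun x => isClosed_iInter fun _ => isClosed_le
        ((WeakDual.eval_continuous x).comp continuous_subtype_val).abs continuous_const)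
    (Set.eq_univ_of_forall fun φ => by
      obtain ⟨R, hR⟩ := hB (WeakDual.toStrongDual φ)
      obtain ⟨n, hn⟩ := exists_nat_ge R
      exact Set.mem_iUnion.2 ⟨n, fun x hx => (hR x hx).trans hn⟩)
  obtain ⟨V, hV, hVn⟩ := mem_nhds_subtype _ _ _ |>.1 (mem_interior_iff_mem_nhds.1 hφ₀)
  have hev : ∀ᶠ t in 𝓝 (0 : ℝ), ∀ φ ∈ seminormPolar p,
      (φ₀ : WeakDual ℝ E) + t • (φ - φ₀) ∈ V := by
    refine hK.eventually_forall_of_forall_eventually fun φ _ => ?_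
    have hc : Continuous fun q : ℝ × WeakDual ℝ E => (φ₀ : WeakDual ℝ E) + q.1 • (q.2 - φ₀) := by
      fun_prop
    refine hc.continuousAt.eventually (p := (· ∈ V)) ?_
    simpa using hV
  obtain ⟨δ, hδ, hδV⟩ := Metric.eventually_nhds_iff.1 hev
  let t := min (δ / 2) 1
  have ht : 0 < t := by positivity
  have htV := hδV (y := t) (by
    rw [dist_zero_right, Real.norm_of_nonneg ht.le]
    exact (min_le_left _ _).trans_lt (by linarith))
  -- Write `t * φ x` as a value bounded by `n` minus `(1 - t) * φ₀ x`; here `t ≤ 1` also keeps the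
  -- combination in the polar.
  refine ⟨2 * n / t, fun x hx => ?_⟩
  obtain ⟨φ, hφ, hφx⟩ := exists_mem_seminormPolar_eq hp x
  have hmem : (φ₀ : WeakDual ℝ E) + t • (φ - φ₀) ∈ seminormPolar p :=
    (convex_seminormPolar p).add_smul_sub_mem φ₀.2 hφ ⟨ht.le, min_le_right _ _⟩
  have h1 : |φ₀.1 x + t * (φ x - φ₀.1 x)| ≤ n := hVn (a := ⟨_, hmem⟩) (htV φ hφ) x hx
  have h0 : |φ₀.1 x| ≤ n := interior_subset hφ₀ x hx
  rw [← hφx, le_div_iff₀ ht]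
  have := min_le_right (δ / 2) 1
  have h3 := abs_le.1 h1
  have h4 := abs_le.1 h0
  change t ≤ 1 at this
  nlinarith

theorem IsRelativelyWeaklyCompact.isVonNBounded {B : Set E} (hB : IsRelativelyWeaklyCompact B) :
    Bornology.IsVonNBounded ℝ B := by
  refine isVonNBounded_of_forall_dual fun φ => ?_
  obtain ⟨R, hR⟩ := (hB.image (continuous_weakSpace_dual φ)).isBounded.exists_norm_le
  exact ⟨R, fun x hx => hR _ ⟨_, subset_closure ⟨x, hx, rfl⟩, rfl⟩⟩

theorem IsWeaklyCompact.isRelativelyWeaklyCompact [T2Space E] {B C : Set E}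
    (hC : IsWeaklyCompact C) (h : B ⊆ C) : IsRelativelyWeaklyCompact B := by
  exact hC.closure_of_subset (Set.image_mono h)

theorem Bornology.IsVonNBounded.convexHull {B : Set E} (hB : IsVonNBounded ℝ B) :
    IsVonNBounded ℝ (convexHull ℝ B) := by
  refine isVonNBounded_iff_forall_seminorm.2 fun p hp => ?_
  obtain ⟨R, hR⟩ := isVonNBounded_iff_forall_seminorm.1 hB p hp
  refine ⟨R, fun x hx => ?_⟩
  have hconv : Convex ℝ {x | p x ≤ R} := by simpa using p.convexOn.convex_le R
  exact convexHull_min hR hconv hx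

theorem evalFamily_convexHull (B : Set E) (M : Set (WeakDual ℝ E)) :
    evalFamily (convexHull ℝ B) M = convexHull ℝ (evalFamily B M) :=
  IsLinearMap.image_convexHull (f := fun (x : E) (φ : M) => (φ : WeakDual ℝ E) x)
    ⟨fun x y => funext fun φ => map_add (φ : WeakDual ℝ E) x y,
      fun c x => funext fun φ => map_smul (φ : WeakDual ℝ E) c x⟩ B

theorem hasDoubleLimitProperty_convexHull_seminormPolar {B : Set E}
    (hb : Bornology.IsVonNBounded ℝ B) (hB : IsDLPSet B) {p : Seminorm ℝ E} (hp : Continuous p) :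
    HasDoubleLimitProperty (evalFamily (convexHull ℝ B) (seminormPolar p)) := by
  obtain ⟨R, hR⟩ := isVonNBounded_iff_forall_seminorm.1 hb p hp
  rw [evalFamily_convexHull]
  refine (hB _ (isEquicontinuousWeakStarCompact_seminormPolar hp)).convexHull (R := R) ?_
  rintro _ ⟨x, hx, rfl⟩ φ
  exact (φ.2 x).trans (hR x hx)

/-- Mazur: the original and weak closures of a convex set coincide. -/
theorem IsRelativelyWeaklyCompact.isWeaklyCompact_closure {C : Set E}
    (hC : IsRelativelyWeaklyCompact C) (hconv : Convex ℝ C) : IsWeaklyCompact (closure C) := by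
  rw [IsWeaklyCompact, hconv.toWeakSpace_closure ℝ]
  exact hC

end WeakCompactness

/-! ### Krein's theorem, semi-reflexivity and the bipolar argument -/

section QuasiComplete

variable {E : Type*} [AddCommGroup E] [Module ℝ E] [UniformSpace E] [IsUniformAddGroup E]
  [ContinuousSMul ℝ E] [LocallyConvexSpace ℝ E] [T2Space E]

/-- Krein's theorem with Grothendieck's double limit condition. -/
theorem IsDLPSet.isWeaklyCompact_closure_convexHull [QuasiCompleteSpace ℝ E] {B : Set E}
    (hb : Bornology.IsVonNBounded ℝ B) (hB : IsDLPSet B) :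
    IsWeaklyCompact (closure (convexHull ℝ B)) := by
  refine (isRelativelyWeaklyCompact_of_closure_subset hb.convexHull.exists_abs_dual_le
    fun z hz => ?_).isWeaklyCompact_closure (convex_convexHull ℝ B)
  obtain ⟨x, -, hx⟩ := exists_dualEval_eq_of_mem_closure (convex_convexHull ℝ B) hb.convexHull
    (fun p hp => hasDoubleLimitProperty_convexHull_seminormPolar hb hB hp) hz
  exact ⟨x, hx⟩

/-- A Cauchy filter with a weak cluster point converges to it. -/
theorem le_nhds_of_cauchy_of_clusterPt_weak {l : Filter E} (hl : Cauchy l) {x : E}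
    (hx : ClusterPt (toWeakSpace ℝ E x) (l.map (toWeakSpace ℝ E))) : l ≤ 𝓝 x := by
  intro W hW
  have hW0 : (fun y => x + y) ⁻¹' W ∈ 𝓝 (0 : E) :=
    (continuous_const.add continuous_id).continuousAt.preimage_mem_nhds (by simpa using hW)
  obtain ⟨p, hp, r, hr, hpW⟩ := exists_seminorm_ball_subset hW0
  have hU : {q : E × E | p (q.2 - q.1) < r / 2} ∈ uniformity E := by
    rw [uniformity_eq_comap_nhds_zero]
    refine ⟨{y | p y < r / 2}, ?_, fun q hq => hq⟩
    exact (isOpen_lt hp continuous_const).mem_nhds (by simpa using half_pos hr)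
  obtain ⟨t, ht, htU⟩ := (cauchy_iff.1 hl).2 _ hU
  refine mem_of_superset ht fun y hy => ?_
  -- Closed seminorm balls are convex, hence weakly closed, so the weak cluster point inherits the
  -- Cauchy estimate.
  have hcl : IsClosed {w : WeakSpace ℝ E | p ((toWeakSpace ℝ E).symm w - y) ≤ r / 2} := by
    have hconv : Convex ℝ {w : E | p (w - y) ≤ r / 2} := by
      have := (p.convex_closedBall y (r / 2))
      rwa [Seminorm.closedBall] at this
    have hc : IsClosed {w : E | p (w - y) ≤ r / 2} :=
      isClosed_le (hp.comp (continuous_id.sub continuous_const)) continuous_const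
    have := hconv.toWeakSpace_closure ℝ
    rw [hc.closure_eq] at this
    have h2 := isClosed_closure (s := toWeakSpace ℝ E '' {w : E | p (w - y) ≤ r / 2})
    rw [← this, LinearEquiv.image_eq_preimage_symm] at h2
    exact h2
  have hmem : {w : WeakSpace ℝ E | p ((toWeakSpace ℝ E).symm w - y) ≤ r / 2} ∈
      l.map (toWeakSpace ℝ E) :=
    mem_map.2 (mem_of_superset ht fun w hw => by
      have : p (w - y) < r / 2 := htU (Set.mk_mem_prod hy hw)
      exact this.le)
  have hxy : p (x - y) ≤ r / 2 := hcl.closure_subset (mem_closure_iff_clusterPt.2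
    (hx.mono (le_principal_iff.2 hmem)))
  have := hpW (y - x) (by
    rw [map_sub_rev]
    linarith)
  simpa using this

/-- In a semi-reflexive space, bounded sets are relatively weakly compact. -/
theorem IsSemiReflexive.isRelativelyWeaklyCompact (hE : IsSemiReflexive E) {B : Set E}
    (hB : Bornology.IsVonNBounded ℝ B) : IsRelativelyWeaklyCompact B := by
  refine isRelativelyWeaklyCompact_of_closure_subset hB.exists_abs_dual_le fun z hz => ?_
  have hlin := map_lincomb_of_mem_closure_dualEval hz
  let g : StrongDual ℝ E →ₗ[ℝ] ℝ :=
    { toFun := z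
      map_add' := fun φ ψ => by simpa using hlin 1 1 φ ψ
      map_smul' := fun c φ => by simpa using hlin c 0 φ 0 }
  -- A functional that is at most `ε / 2` in absolute value on `B` has the same bound under `z`;
  -- such functionals form a strong neighbourhood of zero.
  have hg : Continuous g := by
    apply continuous_of_continuousAt_zero g
    rw [ContinuousAt, map_zero, Metric.tendsto_nhds]
    intro ε hε
    filter_upwards [(ContinuousLinearMap.hasBasis_nhds_zero (σ := RingHom.id ℝ) (E := E)
      (F := ℝ)).mem_of_mem (i := (B, Metric.closedBall 0 (ε / 2)))
      ⟨hB, Metric.closedBall_mem_nhds 0 (half_pos hε)⟩] with φ hφ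
    have hcl : IsClosed {w : StrongDual ℝ E → ℝ | w φ ∈ Metric.closedBall (0 : ℝ) (ε / 2)} :=
      Metric.isClosed_closedBall.preimage (continuous_apply φ)
    have hzφ : z φ ∈ Metric.closedBall (0 : ℝ) (ε / 2) := by
      refine closure_minimal ?_ hcl hz
      rintro _ ⟨x, hx, rfl⟩
      exact hφ x hx
    exact (Metric.mem_closedBall.1 hzφ).trans_lt (half_lt_self hε)
  obtain ⟨x, hx⟩ := hE ⟨g, hg⟩
  exact ⟨x, funext fun φ => congrArg (fun w : StrongDual ℝ (StrongDual ℝ E) => w φ) hx⟩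

theorem IsSemiReflexive.quasiCompleteSpace (hE : IsSemiReflexive E) :
    QuasiCompleteSpace ℝ E := by
  refine ⟨fun B hb hcl l hl hlB => ?_⟩
  have hne := hl.1
  have hsub : toWeakSpace ℝ E '' B ⊆ closure (toWeakSpace ℝ E '' B) := subset_closure
  obtain ⟨w, -, hw⟩ := (hE.isRelativelyWeaklyCompact hb).exists_clusterPt
    (f := l.map (toWeakSpace ℝ E)) (le_principal_iff.2 (mem_map.2
      (mem_of_superset (le_principal_iff.1 hlB) fun x hx => hsub (Set.mem_image_of_mem _ hx))))
  obtain ⟨x, rfl⟩ := (toWeakSpace ℝ E).surjective w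
  have hlx := le_nhds_of_cauchy_of_clusterPt_weak hl hw
  have hmem : ∀ᶠ y in l, y ∈ B := le_principal_iff.1 hlB
  exact ⟨x, hcl.mem_of_tendsto (f := id) hlx hmem, hlx⟩

/-- Continuous linear functionals on a product of copies of `ℝ` are combinations of coordinates. -/
theorem mem_span_range_proj {ι : Type*} (f : StrongDual ℝ (ι → ℝ)) :
    (f : (ι → ℝ) →ₗ[ℝ] ℝ) ∈
      Submodule.span ℝ (Set.range fun i => (LinearMap.proj i : (ι → ℝ) →ₗ[ℝ] ℝ)) :=
  (LinearMap.mem_span_iff_continuous _).2 f.continuous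

/-- A functional on the product is a finite combination of coordinates; on linear `g` this collapses
to evaluation at the same combination of the indices. It turns a separating functional into an
element of the dual. -/
theorem exists_dual_forall_apply_eq (f : StrongDual ℝ (StrongDual ℝ E → ℝ)) :
    ∃ φ : StrongDual ℝ E, ∀ g : StrongDual ℝ E →ₗ[ℝ] ℝ, f g = g φ := by
  have key : ∀ f' ∈ Submodule.span ℝ (Set.range fun φ : StrongDual ℝ E =>
      (LinearMap.proj φ : (StrongDual ℝ E → ℝ) →ₗ[ℝ] ℝ)),
      ∃ φ : StrongDual ℝ E, ∀ g : StrongDual ℝ E →ₗ[ℝ] ℝ, f' g = g φ := by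
    intro f' hf'
    induction hf' using Submodule.span_induction with
    | mem _ h => obtain ⟨φ, rfl⟩ := h; exact ⟨φ, fun g => rfl⟩
    | zero => exact ⟨0, fun g => by simp⟩
    | add _ _ _ _ h₁ h₂ =>
      obtain ⟨φ, hφ⟩ := h₁
      obtain ⟨ψ, hψ⟩ := h₂
      exact ⟨φ + ψ, fun g => by simp [hφ, hψ]⟩
    | smul c _ _ h =>
      obtain ⟨φ, hφ⟩ := h
      exact ⟨c • φ, fun g => by simp [hφ]⟩
  exact key _ (mem_span_range_proj f)

/-- The bipolar theorem: a strongly continuous functional on the dual is a pointwise limit of points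
of a bounded convex set. -/
theorem exists_convex_isVonNBounded_mem_closure (g : StrongDual ℝ (StrongDual ℝ E)) :
    ∃ C : Set E, Convex ℝ C ∧ Bornology.IsVonNBounded ℝ C ∧ ⇑g ∈ closure (dualEval '' C) := by
  obtain ⟨⟨B, ε⟩, ⟨hB, hε⟩, hBε⟩ := (ContinuousLinearMap.hasBasis_nhds_zero_of_basis
    (σ := RingHom.id ℝ) (E := E) (F := ℝ) Metric.nhds_basis_ball).mem_iff.1
      (g.continuous.continuousAt.preimage_mem_nhds (x := 0) (t := Metric.ball 0 1)
        (by simpa using Metric.ball_mem_nhds 0 one_pos))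
  -- The point 0 forces the separating constant `u` to be positive, the signs turn one-sided bounds
  -- into absolute values, and the scaling puts `u⁻¹ • φ` in the neighbourhood where `g` is below 1
  -- in absolute value, against `u < g φ`.
  let D : Set E := {x | x = 0 ∨ ∃ b ∈ B, x = ε⁻¹ • b ∨ x = -(ε⁻¹ • b)}
  have hD : Bornology.IsVonNBounded ℝ D := by
    refine isVonNBounded_iff_forall_seminorm.2 fun p hp => ?_
    obtain ⟨R, hR⟩ := isVonNBounded_iff_forall_seminorm.1 hB p hp
    have hε' : 0 ≤ ε⁻¹ := (inv_pos.2 hε).le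
    have hb : ∀ b ∈ B, p (ε⁻¹ • b) ≤ ε⁻¹ * |R| := fun b hb => by
      rw [map_smul_eq_mul, Real.norm_of_nonneg hε']
      exact mul_le_mul_of_nonneg_left ((hR b hb).trans (le_abs_self R)) hε'
    refine ⟨ε⁻¹ * |R|, ?_⟩
    rintro x (rfl | ⟨b, hbB, rfl | rfl⟩)
    · rw [map_zero]; positivity
    · exact hb b hbB
    · rw [map_neg_eq_map]; exact hb b hbB
  refine ⟨convexHull ℝ D, convex_convexHull ℝ D, hD.convexHull, ?_⟩
  by_contra hg
  have hconv : Convex ℝ (dualEval '' convexHull ℝ D) :=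
    (convex_convexHull ℝ D).is_linear_image (f := dualEval)
      ⟨fun x y => funext fun φ => map_add φ x y, fun c x => funext fun φ => map_smul φ c x⟩
  obtain ⟨f, u, hfu, hug⟩ := geometric_hahn_banach_closed_point hconv.closure isClosed_closure hg
  obtain ⟨φ, hφ⟩ := exists_dual_forall_apply_eq f
  have hgφ : u < g φ := by simpa using hug.trans_eq (hφ g)
  have hDφ : ∀ x ∈ D, φ x < u := fun x hx => by
    have h1 := hfu _ (subset_closure (Set.mem_image_of_mem dualEval (subset_convexHull ℝ D hx)))
    have h2 := hφ (bidualEmbedding E x : StrongDual ℝ E →ₗ[ℝ] ℝ)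
    exact h2.symm.trans_lt h1
  have hu : 0 < u := by simpa using hDφ 0 (Or.inl rfl)
  have hmem : u⁻¹ • φ ∈ {ψ : StrongDual ℝ E | ∀ x ∈ B, ψ x ∈ Metric.ball (0 : ℝ) ε} := by
    intro b hb
    have h1 := hDφ _ (Or.inr ⟨b, hb, Or.inl rfl⟩)
    have h2 := hDφ _ (Or.inr ⟨b, hb, Or.inr rfl⟩)
    rw [map_neg] at h2
    rw [map_smul, smul_eq_mul, inv_mul_eq_div] at h1 h2
    have h3 : |φ b / ε| < u := abs_lt.2 ⟨by linarith, h1⟩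
    rw [abs_div, abs_of_pos hε, div_lt_iff₀ hε] at h3
    rw [mem_ball_zero_iff, Real.norm_eq_abs]
    change |u⁻¹ * φ b| < ε
    rwa [abs_mul, abs_of_pos (inv_pos.2 hu), inv_mul_lt_iff₀ hu]
  have h1 : |g (u⁻¹ • φ)| < 1 := by simpa using hBε hmem
  rw [map_smul, smul_eq_mul, abs_mul, abs_of_pos (inv_pos.2 hu), inv_mul_lt_iff₀ hu, mul_one] at h1
  exact (hgφ.trans_le (le_abs_self _)).not_gt h1

theorem isSemiReflexive_of_quasiComplete_of_isDLPSpace [QuasiCompleteSpace ℝ E]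
    (hE : IsDLPSpace E) : IsSemiReflexive E := by
  intro g
  obtain ⟨C, hC, hb, hg⟩ := exists_convex_isVonNBounded_mem_closure g
  obtain ⟨x, -, hx⟩ := exists_dualEval_eq_of_mem_closure hC hb
    (fun p hp => hE C hb _ (isEquicontinuousWeakStarCompact_seminormPolar hp)) hg
  exact ⟨x, ContinuousLinearMap.ext fun φ => congrFun hx φ⟩

end QuasiComplete

theorem mainTheorem10 {E : Type*} [AddCommGroup E] [Module ℝ E] [UniformSpace E]
    [IsUniformAddGroup E] [ContinuousSMul ℝ E] [LocallyConvexSpace ℝ E] [T2Space E] :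
    (IsSemiReflexive E ↔ (QuasiCompleteSpace ℝ E ∧ IsDLPSpace E)) ∧
    (QuasiCompleteSpace ℝ E → ∀ B : Set E,
      List.TFAE
        [Bornology.IsVonNBounded ℝ B ∧ IsDLPSet B,
          IsRelativelyWeaklyCompact B,
          IsWeaklyCompact (closure (convexHull ℝ B))]) := by
  refine ⟨⟨fun h => ⟨h.quasiCompleteSpace,
    fun B hB => (h.isRelativelyWeaklyCompact hB).isDLPSet⟩,
    fun ⟨_, h⟩ => isSemiReflexive_of_quasiComplete_of_isDLPSpace h⟩, fun _ B => ?_⟩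
  tfae_have 1 → 3 := fun ⟨hb, hB⟩ => hB.isWeaklyCompact_closure_convexHull hb
  tfae_have 3 → 2 := fun h =>
    h.isRelativelyWeaklyCompact ((subset_convexHull ℝ B).trans subset_closure)
  tfae_have 2 → 1 := fun h => ⟨h.isVonNBounded, h.isDLPSet⟩
  tfae_finish
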